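/- For $n\ge 0$ let $\mathbf B_n$ be the set of permutations of length $n$ in the juxtaposition class $\mathbf B=\mathrm{Av}(321\mid 21)$, i.e. the permutations $\pi$ of $\{1,\dots,n\}$ whose one-line notation can be written as a concatenation $\pi=AB$ of two (possibly empty) words such that $A$ avoids the pattern $321$ and $B$ avoids the pattern $21$ (so $B$ is increasing). Here a word avoids a pattern if none of its subsequences is order isomorphic to that pattern. Theorem. The ordinary generating function $s_{\mathbf B}(z)=\sum_{n\ge 0}|\mathbf B_n|z^n\in\mathbb Q[[z]]$ (the empty permutation is counted, $|\mathbf B_0|=1$) is algebraic over $\mathbb Q[z]$ and is given by $$s_{\mathbf B}(z)=-\frac{1-\sqrt{1-4z}+z\left(-4+\sqrt{1-4z}+\sqrt{1-5z}/\sqrt{1-z}\right)}{2z^2},$$ where $\sqrt{1-az}$ denotes the formal power series with constant term $1$ whose square is $1-az$, and the quotient is taken in the field of formal Laurent series $\mathbb Q((z))$. The values $|\mathbf B_n|$ for $n=1,\dots,12$ are $$1,\ 2,\ 6,\ 23,\ 98,\ 434,\ 1949,\ 8803,\ 39888,\ 181201,\ 825201,\ 3767757.$$ -/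

import Mathlib

open scoped PowerSeries LaurentSeries

/-- The word `w`, indexed by a linearly ordered set of positions, contains the pattern `p`:
some subsequence of `w` is order isomorphic to `p`. -/
def ContainsPattern {ι α : Type*} [LinearOrder ι] [LinearOrder α] {k : ℕ}
    (w : ι → α) (p : Fin k → ℕ) : Prop :=
  ∃ f : Fin k ↪o ι, ∀ i j : Fin k, w (f i) < w (f j) ↔ p i < p j

/-- The word `w` avoids the pattern `p`. -/
def AvoidsPattern {ι α : Type*} [LinearOrder ι] [LinearOrder α] {k : ℕ}
    (w : ι → α) (p : Fin k → ℕ) : Prop :=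
  ¬ ContainsPattern w p

/-- `juxtapositionClass p q n` is the set of permutations of length `n` in the juxtaposition
class `Av(p|q)`: the permutations whose one-line notation is a concatenation `AB` (`A` being the
first `m` entries, where `0 ≤ m ≤ n`) such that `A` avoids `p` and `B` avoids `q`. -/
def juxtapositionClass {k l : ℕ} (p : Fin k → ℕ) (q : Fin l → ℕ) (n : ℕ) :
    Set (Equiv.Perm (Fin n)) :=
  {σ | ∃ m : ℕ, m ≤ n ∧
    AvoidsPattern (fun i : {i : Fin n // (i : ℕ) < m} => σ i.1) p ∧
    AvoidsPattern (fun i : {i : Fin n // m ≤ (i : ℕ)} => σ i.1) q}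

/-- The class `Av(321|21)`, by length. -/
def classB (n : ℕ) : Set (Equiv.Perm (Fin n)) :=
  juxtapositionClass ![3, 2, 1] ![2, 1] n

/-- The ordinary generating function of `Av(321|21)`, as a formal power series. -/
noncomputable def genFunB : ℚ⟦X⟧ :=
  PowerSeries.mk fun n => ((classB n).ncard : ℚ)

/-- The formal power series `√(1 - a z)`, that is, the binomial series `(1 + x) ^ (1 / 2)`
evaluated at `x = - a z`. -/
noncomputable def sqrtOneSub (a : ℚ) : ℚ⟦X⟧ :=
  PowerSeries.rescale (-a) (PowerSeries.binomialSeries ℚ (1 / 2 : ℚ))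

/-- `sqrtOneSub a` is a square root of `1 - a z` ... -/
theorem sqrtOneSub_sq (a : ℚ) :
    sqrtOneSub a ^ 2 = 1 - PowerSeries.C a * PowerSeries.X := by
  have h : PowerSeries.binomialSeries ℚ (1 / 2 : ℚ) ^ 2 = 1 + PowerSeries.X := by
    rw [sq, ← PowerSeries.binomialSeries_add]
    have := PowerSeries.binomialSeries_nat (R := ℚ) (A := ℚ) 1
    norm_num at this ⊢
    exact this
  rw [sqrtOneSub, ← map_pow, h]
  simp [PowerSeries.rescale_X, sub_eq_add_neg]

/-- ... namely the one with constant term `1`. -/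
theorem constantCoeff_sqrtOneSub (a : ℚ) :
    PowerSeries.constantCoeff (sqrtOneSub a) = 1 := by
  rw [← PowerSeries.coeff_zero_eq_constantCoeff_apply, sqrtOneSub, PowerSeries.coeff_rescale]
  simp

/-! Call `m` a divider of `σ` if the first `m` entries avoid 321 and the rest increase. The dividers
of `σ` form an interval, so, summing (points minus steps) over all `σ`, each permutation of the
class counts exactly once (`ncard_classB_add`). Pairs (permutation, divider `m`) number `n.choose m
* catalan m` (`griddedCount_add`): choose the values of the prefix and a 321-avoiding order on them.
A step from `m` to `m + 1` amounts to a 321-avoider increasing from `m`; these are ballot numbers,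
and all steps together number C_{n+1} - C_n (`sum_avoidCount_add`). Hence |B_n| = Σ_m binom(n,m) C_m
+ C_n - C_{n+1}. The binomial transform has the series D(z) = C(z/(1-z))/(1-z), and the quadratic
equations for C and D give √(1-4z) = 1 - 2zC and √(1-5z) = √(1-z)(1 - 2zD). -/

open Equiv

/-! ### Dividers of a permutation: points minus steps -/

/-- The first `m` entries of `σ` avoid the pattern `321`. -/
def PrefixAvoids {n : ℕ} (σ : Perm (Fin n)) (m : ℕ) : Prop :=
  ∀ i j k : Fin n, i < j → j < k → (k : ℕ) < m → σ k < σ j → ¬ σ j < σ i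

/-- The entries of `σ` from position `m` on are increasing. -/
def IncreasingFrom {n : ℕ} (σ : Perm (Fin n)) (m : ℕ) : Prop :=
  ∀ i j : Fin n, m ≤ (i : ℕ) → i < j → σ i < σ j

instance {n : ℕ} (σ : Perm (Fin n)) (m : ℕ) : Decidable (PrefixAvoids σ m) := by
  unfold PrefixAvoids; infer_instance

instance {n : ℕ} (σ : Perm (Fin n)) (m : ℕ) : Decidable (IncreasingFrom σ m) := by
  unfold IncreasingFrom; infer_instance

theorem PrefixAvoids.anti {n : ℕ} {σ : Perm (Fin n)} {m m' : ℕ} (h : PrefixAvoids σ m')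
    (hm : m ≤ m') : PrefixAvoids σ m :=
  fun i j k hij hjk hk => h i j k hij hjk (hk.trans_le hm)

theorem IncreasingFrom.mono {n : ℕ} {σ : Perm (Fin n)} {m m' : ℕ} (h : IncreasingFrom σ m)
    (hm : m ≤ m') : IncreasingFrom σ m' :=
  fun i j hi hij => h i j (hm.trans hi) hij

theorem increasingFrom_of_le {n : ℕ} (σ : Perm (Fin n)) {m : ℕ} (h : n ≤ m + 1) :
    IncreasingFrom σ m := by
  intro i j hi hij
  have := j.2
  have : (i : ℕ) < j := hij
  omega

/-- In a 321 ending beyond position `m`, the middle entry lies before `m`, as the suffix has no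
descent. The entry at `m` is then no larger than the last one and can replace it. -/
theorem prefixAvoids_succ_and_increasingFrom {n : ℕ} (σ : Perm (Fin n)) {m : ℕ} (hm : m < n) :
    PrefixAvoids σ (m + 1) ∧ IncreasingFrom σ m ↔ PrefixAvoids σ n ∧ IncreasingFrom σ m := by
  refine ⟨fun ⟨hP, hQ⟩ => ⟨fun i j k hij hjk _ hkj hji => ?_, hQ⟩,
    fun ⟨hP, hQ⟩ => ⟨hP.anti hm, hQ⟩⟩
  by_cases hk : (k : ℕ) < m + 1
  · exact hP i j k hij hjk hk hkj hji
  by_cases hj : m ≤ (j : ℕ)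
  · exact (hQ j k hj hjk).not_gt hkj
  · have hmk : σ ⟨m, hm⟩ < σ k := hQ _ _ le_rfl (Fin.lt_def.2 (by simp; omega))
    exact hP i j ⟨m, hm⟩ hij (Fin.lt_def.2 (by simp; omega)) (by simp) (hmk.trans hkj) hji

/-- An antitone and a monotone condition hold simultaneously on an interval, and the number of
points of a nonempty interval exceeds the number of its steps by one. -/
theorem card_filter_interval (P Q : ℕ → Prop) [DecidablePred P] [DecidablePred Q]
    (hP : Antitone P) (hQ : Monotone Q) (n : ℕ)
    [DecidablePred fun n => ∃ m ≤ n, P m ∧ Q m] :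
    (if ∃ m ≤ n, P m ∧ Q m then 1 else 0) +
      ∑ m ∈ Finset.range n, (if P (m + 1) ∧ Q m then 1 else 0) =
    ∑ m ∈ Finset.range (n + 1), if P m ∧ Q m then 1 else 0 := by
  induction n with
  | zero =>
    rw [Finset.sum_range_zero, Finset.sum_range_one, add_zero]
    simp only [Nat.le_zero, exists_eq_left]
  | succ n ih =>
    rw [Finset.sum_range_succ, Finset.sum_range_succ _ (n + 1), ← ih]
    have hex : (∃ m ≤ n + 1, P m ∧ Q m) ↔ (∃ m ≤ n, P m ∧ Q m) ∨ (P (n + 1) ∧ Q (n + 1)) := by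
      constructor
      · rintro ⟨m, hm, h⟩
        rcases Nat.lt_or_ge n m with h' | h'
        · obtain rfl : m = n + 1 := by omega
          exact .inr h
        · exact .inl ⟨m, h', h⟩
      · rintro (⟨m, hm, h⟩ | h)
        · exact ⟨m, by omega, h⟩
        · exact ⟨_, le_rfl, h⟩
    -- If `P (n + 1)` and `Q n` hold, a new point and a new step appear together. If only `Q n`
    -- fails, `n + 1` can only be the first point; if `P (n + 1)` fails, nothing is added.
    by_cases h1 : P (n + 1)
    · by_cases h2 : Q n
      · have hE : ∃ m ≤ n, P m ∧ Q m := ⟨n, le_rfl, hP (Nat.le_succ n) h1, h2⟩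
        have h3 : Q (n + 1) := hQ (Nat.le_succ n) h2
        simp only [hex, hE, h1, h2, h3, true_or, and_self, if_true]
        ring
      · have hE : ¬ ∃ m ≤ n, P m ∧ Q m := fun ⟨m, hm, _, h⟩ => h2 (hQ hm h)
        simp only [hex, hE, h1, h2, false_or, true_and, if_false]
        ring
    · simp only [hex, h1, false_and, or_false, if_false]
      ring

theorem avoidsPattern_321 {ι α : Type*} [LinearOrder ι] [LinearOrder α] (w : ι → α) :
    AvoidsPattern w ![3, 2, 1] ↔ ∀ i j k, i < j → j < k → w k < w j → ¬ w j < w i := by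
  constructor
  · intro h i j k hij hjk hkj hji
    refine h ⟨OrderEmbedding.ofStrictMono ![i, j, k] ?_, ?_⟩
    · intro a b hab
      fin_cases a <;> fin_cases b <;> simp_all [hij.trans hjk]
    · intro a b
      have h1 := hkj.trans hji
      change w (![i, j, k] a) < w (![i, j, k] b) ↔ _
      fin_cases a <;> fin_cases b <;> simp [hkj, hji, h1, h1.le, hkj.le, hji.le]
  · rintro h ⟨f, hf⟩
    exact h (f 0) (f 1) (f 2) (f.lt_iff_lt.2 (by decide)) (f.lt_iff_lt.2 (by decide))
      ((hf 2 1).2 (by decide)) ((hf 1 0).2 (by decide))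

theorem avoidsPattern_21 {ι α : Type*} [LinearOrder ι] [LinearOrder α] (w : ι → α) :
    AvoidsPattern w ![2, 1] ↔ ∀ i j, i < j → w i ≤ w j := by
  constructor
  · intro h i j hij
    by_contra! hji
    refine h ⟨OrderEmbedding.ofStrictMono ![i, j] ?_, ?_⟩
    · intro a b hab
      fin_cases a <;> fin_cases b <;> simp_all
    · intro a b
      change w (![i, j] a) < w (![i, j] b) ↔ _
      fin_cases a <;> fin_cases b <;> simp [hji, hji.le]
  · rintro h ⟨f, hf⟩
    exact (h (f 0) (f 1) (f.lt_iff_lt.2 (by decide))).not_gt ((hf 1 0).2 (by decide))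

theorem mem_classB {n : ℕ} (σ : Perm (Fin n)) :
    σ ∈ classB n ↔ ∃ m ≤ n, PrefixAvoids σ m ∧ IncreasingFrom σ m := by
  simp only [classB, juxtapositionClass, Set.mem_ofPred_eq, avoidsPattern_321, avoidsPattern_21]
  refine exists_congr fun m => and_congr_right fun _ => and_congr ?_ ?_
  · exact ⟨fun h i j k hij hjk hk =>
      h ⟨i, by have : (i : ℕ) < j := hij; have : (j : ℕ) < k := hjk; omega⟩
        ⟨j, by have : (j : ℕ) < k := hjk; omega⟩ ⟨k, hk⟩ hij hjk,
      fun h i j k hij hjk => h i j k hij hjk k.2⟩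
  · exact ⟨fun h i j hi hij => lt_of_le_of_ne
        (h ⟨i, hi⟩ ⟨j, by have : (i : ℕ) < j := hij; omega⟩ hij) (fun e => hij.ne (σ.injective e)),
      fun h i j hij => (h i j i.2 hij).le⟩

/-- The number of `321`-avoiding permutations of length `n` that increase from position `m` on. -/
def avoidCount (n m : ℕ) : ℕ :=
  (Finset.univ.filter fun σ : Perm (Fin n) => PrefixAvoids σ n ∧ IncreasingFrom σ m).card

/-- The number of permutations of length `n` whose first `m` entries avoid `321` and whose other
entries increase. -/
def griddedCount (n m : ℕ) : ℕ :=
  (Finset.univ.filter fun σ : Perm (Fin n) => PrefixAvoids σ m ∧ IncreasingFrom σ m).card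

theorem ncard_classB_add (n : ℕ) :
    (classB n).ncard + ∑ m ∈ Finset.range n, avoidCount n m =
      ∑ m ∈ Finset.range (n + 1), griddedCount n m := by
  classical
  have h1 : (classB n).ncard =
      ∑ σ : Perm (Fin n), if ∃ m ≤ n, PrefixAvoids σ m ∧ IncreasingFrom σ m then 1 else 0 := by
    rw [← Finset.card_filter, ← Set.ncard_coe_finset]
    congr 1
    ext σ
    simp [mem_classB]
  have h2 : ∑ m ∈ Finset.range n, avoidCount n m = ∑ σ : Perm (Fin n), ∑ m ∈ Finset.range n,
      if PrefixAvoids σ (m + 1) ∧ IncreasingFrom σ m then 1 else 0 := by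
    rw [Finset.sum_comm]
    refine Finset.sum_congr rfl fun m hm => ?_
    rw [avoidCount, Finset.card_filter]
    simp only [prefixAvoids_succ_and_increasingFrom _ (Finset.mem_range.1 hm)]
  have h3 : ∑ m ∈ Finset.range (n + 1), griddedCount n m = ∑ σ : Perm (Fin n),
      ∑ m ∈ Finset.range (n + 1), if PrefixAvoids σ m ∧ IncreasingFrom σ m then 1 else 0 := by
    rw [Finset.sum_comm]
    exact Finset.sum_congr rfl fun m _ => by rw [griddedCount, Finset.card_filter]
  rw [h1, h2, h3, ← Finset.sum_add_distrib]
  exact Finset.sum_congr rfl fun σ _ => card_filter_interval (PrefixAvoids σ) (IncreasingFrom σ)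
    (fun _ _ h hP => hP.anti h) (fun _ _ h hQ => hQ.mono h) n

/-! ### Counting 321-avoiders with increasing suffix: ballot numbers -/

/-- Insert a new maximum at position `p` of a permutation. -/
def insertMax {n : ℕ} (p : Fin (n + 1)) (σ : Perm (Fin n)) : Perm (Fin (n + 1)) :=
  (finSuccEquiv' p).trans ((optionCongr σ).trans (finSuccEquiv' (Fin.last n)).symm)

theorem insertMax_self {n : ℕ} (p : Fin (n + 1)) (σ : Perm (Fin n)) :
    insertMax p σ p = Fin.last n := by
  simp [insertMax]

theorem insertMax_succAbove {n : ℕ} (p : Fin (n + 1)) (σ : Perm (Fin n)) (i : Fin n) :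
    insertMax p σ (p.succAbove i) = (σ i).castSucc := by
  simp [insertMax]

theorem insertMax_bijective (n : ℕ) :
    Function.Bijective fun x : Fin (n + 1) × Perm (Fin n) => insertMax x.1 x.2 := by
  rw [Fintype.bijective_iff_injective_and_card]
  refine ⟨?_, by simp [Fintype.card_perm, Nat.factorial_succ]⟩
  rintro ⟨p, σ⟩ ⟨q, τ⟩ h
  have h : insertMax p σ = insertMax q τ := h
  obtain rfl : p = q := (insertMax q τ).injective <| by
    rw [insertMax_self, ← h, insertMax_self]
  refine Prod.ext rfl (Equiv.ext fun i => Fin.castSucc_injective n ?_)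
  rw [← insertMax_succAbove p σ, h, insertMax_succAbove]

theorem le_iff_lt_succAbove {n : ℕ} (p : Fin (n + 1)) (i : Fin n) :
    p < p.succAbove i ↔ (p : ℕ) ≤ i := by
  rw [Fin.lt_succAbove_iff_le_castSucc]; rfl

/-- The maximum can only play the role of 3, so it creates a 321 exactly when an inversion lies to
its right. -/
theorem prefixAvoids_insertMax {n : ℕ} (p : Fin (n + 1)) (σ : Perm (Fin n)) :
    PrefixAvoids (insertMax p σ) (n + 1) ↔ PrefixAvoids σ n ∧ IncreasingFrom σ p := by
  constructor
  · intro h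
    refine ⟨fun i j k hij hjk _ hkj hji => ?_, fun i j hi hij => ?_⟩
    · refine h (p.succAbove i) (p.succAbove j) (p.succAbove k) (by simpa) (by simpa) (Fin.is_lt _)
        ?_ ?_ <;> simpa [insertMax_succAbove]
    · by_contra hlt
      have hlt : σ j < σ i := lt_of_le_of_ne (not_lt.1 hlt) fun e => hij.ne' (σ.injective e)
      refine h p (p.succAbove i) (p.succAbove j) ((le_iff_lt_succAbove p i).2 hi) (by simpa)
        (Fin.is_lt _) ?_ ?_
      · simpa [insertMax_succAbove]
      · simp [insertMax_succAbove, insertMax_self, Fin.castSucc_lt_last]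
  · rintro ⟨hP, hQ⟩ i j k hij hjk _ hkj hji
    obtain rfl | ⟨k, rfl⟩ := Fin.eq_self_or_eq_succAbove p k
    · rw [insertMax_self] at hkj
      exact (Fin.le_last _).not_gt hkj
    obtain rfl | ⟨j, rfl⟩ := Fin.eq_self_or_eq_succAbove p j
    · rw [insertMax_self] at hji
      exact (Fin.le_last _).not_gt hji
    simp only [insertMax_succAbove, Fin.castSucc_lt_castSucc_iff] at hkj
    have hjk' : j < k := by simpa using hjk
    obtain rfl | ⟨i, rfl⟩ := Fin.eq_self_or_eq_succAbove p i
    · exact (hQ j k ((le_iff_lt_succAbove _ j).1 hij) hjk').not_gt hkj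
    · simp only [insertMax_succAbove, Fin.castSucc_lt_castSucc_iff] at hji
      exact hP i j k (by simpa using hij) hjk' k.2 hkj hji

theorem increasingFrom_insertMax_last {n : ℕ} (σ : Perm (Fin n)) (m : ℕ) :
    IncreasingFrom (insertMax (Fin.last n) σ) m ↔ IncreasingFrom σ m := by
  have hc (i : Fin n) : insertMax (Fin.last n) σ i.castSucc = (σ i).castSucc := by
    rw [← insertMax_succAbove (Fin.last n), Fin.succAbove_last]
  constructor
  · intro h i j hi hij
    simpa [hc] using h i.castSucc j.castSucc hi (by simpa)
  · intro h i j hi hij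
    obtain ⟨i, rfl⟩ := Fin.exists_castSucc_eq.2 (hij.trans_le (Fin.le_last j)).ne
    rw [hc]
    obtain ⟨j, rfl⟩ | rfl := j.eq_castSucc_or_eq_last
    · simpa [hc] using h i j hi (by simpa using hij)
    · rw [insertMax_self]
      exact Fin.castSucc_lt_last _

theorem increasingFrom_insertMax_castSucc {n : ℕ} (p : Fin n) (σ : Perm (Fin n)) (m : ℕ)
    (hσ : IncreasingFrom σ p) :
    IncreasingFrom (insertMax p.castSucc σ) m ↔ (p : ℕ) < m := by
  constructor
  · intro h
    by_contra! hm
    have := h p.castSucc (p.castSucc.succAbove p) hm ((le_iff_lt_succAbove _ _).2 le_rfl)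
    rw [insertMax_self] at this
    exact (Fin.le_last _).not_gt this
  · intro hm i j hi hij
    have hpi : p.castSucc < i := Fin.lt_def.2 (by simp; omega)
    obtain rfl | ⟨i, rfl⟩ := Fin.eq_self_or_eq_succAbove p.castSucc i
    · exact absurd hpi (lt_irrefl _)
    obtain rfl | ⟨j, rfl⟩ := Fin.eq_self_or_eq_succAbove p.castSucc j
    · exact absurd (hpi.trans hij) (lt_irrefl _)
    simp only [insertMax_succAbove, Fin.castSucc_lt_castSucc_iff]
    exact hσ i j ((le_iff_lt_succAbove _ _).1 hpi) (by simpa using hij)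

theorem avoidCount_succ_eq_sum (n m : ℕ) :
    avoidCount (n + 1) m = ∑ p : Fin (n + 1), (Finset.univ.filter fun σ : Perm (Fin n) =>
      (PrefixAvoids σ n ∧ IncreasingFrom σ p) ∧ IncreasingFrom (insertMax p σ) m).card := by
  simp only [avoidCount, Finset.card_filter]
  rw [← Fintype.sum_prod_type', ← (insertMax_bijective n).sum_comp]
  simp only [prefixAvoids_insertMax]

/-- Insert the maximum at `p`. If `p < n`, a smaller entry follows it, which forces `p < m`; the
remaining conditions are those of `avoidCount n p`. The last position `p = n` supplies the term with
index `m`. -/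
theorem avoidCount_succ {n m : ℕ} (hm : m ≤ n) :
    avoidCount (n + 1) m = ∑ p ∈ Finset.range (m + 1), avoidCount n p := by
  rw [avoidCount_succ_eq_sum, Fin.sum_univ_castSucc, Finset.sum_range_succ]
  congr 1
  · trans ∑ p : Fin n, if (p : ℕ) < m then avoidCount n p else 0
    · refine Finset.sum_congr rfl fun p _ => ?_
      split_ifs with h
      · refine congrArg _ (Finset.filter_congr fun σ _ => and_iff_left_of_imp fun hσ => ?_)
        exact (increasingFrom_insertMax_castSucc p σ m hσ.2).2 h
      · refine Finset.card_eq_zero.2 (Finset.filter_eq_empty_iff.2 fun σ _ hσ => h ?_)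
        exact (increasingFrom_insertMax_castSucc p σ m hσ.1.2).1 hσ.2
    · rw [Fin.sum_univ_eq_sum_range (fun p => if p < m then avoidCount n p else 0),
        ← Finset.sum_filter]
      refine Finset.sum_congr ?_ fun _ _ => rfl
      ext p
      simp only [Finset.mem_filter, Finset.mem_range]
      omega
  · refine congrArg _ (Finset.filter_congr fun σ _ => ?_)
    rw [increasingFrom_insertMax_last]
    exact and_congr_left fun _ =>
      and_iff_left (increasingFrom_of_le σ (by simp))

theorem avoidCount_of_le {n m : ℕ} (h : n ≤ m + 1) : avoidCount n m = avoidCount n n :=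
  congrArg Finset.card (Finset.filter_congr fun σ _ =>
    and_congr_right fun _ => iff_of_true (increasingFrom_of_le σ h)
      (increasingFrom_of_le σ (by omega)))

theorem avoidCount_zero_zero : avoidCount 0 0 = 1 := by decide

/-- Differencing `avoidCount_succ` in `m` gives a Pascal-type recurrence, which the ballot number
binom(n+m,n) - binom(n+m,n+1) also satisfies. -/
theorem avoidCount_add_choose {n m : ℕ} (hm : m ≤ n) :
    avoidCount n m + (n + m).choose (n + 1) = (n + m).choose n := by
  induction n generalizing m with
  | zero =>
    obtain rfl : m = 0 := by omega
    simp [avoidCount_zero_zero]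
  | succ n ih =>
    have key : ∀ m ≤ n, avoidCount (n + 1) m + (n + 1 + m).choose (n + 1 + 1) =
        (n + 1 + m).choose (n + 1) := by
      intro m hm
      induction m with
      | zero =>
        have := ih (Nat.zero_le n)
        rw [avoidCount_succ hm]
        simpa using this
      | succ m ihm =>
        have h1 := ihm (by omega)
        have h2 := ih hm
        rw [avoidCount_succ hm, Finset.sum_range_succ, ← avoidCount_succ (by omega)]
        rw [show n + 1 + (m + 1) = (n + 1 + m) + 1 by ring, Nat.choose_succ_succ' _ (n + 1),
          Nat.choose_succ_succ' _ n]
        rw [show n + (m + 1) = n + 1 + m by ring] at h2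
        omega
    -- The diagonal escapes the recurrence, but a suffix of one entry imposes no condition, so it
    -- agrees with its neighbour.
    rcases hm.eq_or_lt with rfl | hm
    · have h1 := key n le_rfl
      rw [avoidCount_of_le le_rfl] at h1
      rw [show n + 1 + (n + 1) = (n + 1 + n) + 1 by ring, Nat.choose_succ_succ' _ (n + 1),
          Nat.choose_succ_succ' _ n]
      have : (n + 1 + n).choose (n + 1) = (n + 1 + n).choose n := Nat.choose_symm_of_eq_add rfl
      omega
    · exact key m (by omega)

theorem avoidCount_self (n : ℕ) : avoidCount n n = catalan n := by
  have h1 := avoidCount_add_choose (le_refl n)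
  have h2 := Nat.choose_succ_right_eq (n + n) n
  rw [Nat.add_sub_cancel] at h2
  have h3 := succ_mul_catalan_eq_centralBinom n
  rw [Nat.centralBinom_eq_two_mul_choose, two_mul] at h3
  refine Nat.eq_of_mul_eq_mul_left (Nat.succ_pos n) ?_
  rw [Nat.succ_eq_add_one, h3]
  nlinarith

theorem sum_avoidCount_add (n : ℕ) :
    ∑ m ∈ Finset.range n, avoidCount n m + catalan n = catalan (n + 1) := by
  rw [← avoidCount_self n, ← Finset.sum_range_succ, ← avoidCount_succ le_rfl,
    avoidCount_of_le le_rfl, avoidCount_self]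

/-! ### Permutations with a chosen divider -/

/-- The permutation whose first `m` entries form the set `S`, ordered as in `τ`, and whose other
entries increase. -/
def gluePerm {m l : ℕ} (S : Finset (Fin (m + l))) (hS : S.card = m) (hS' : Sᶜ.card = l)
    (τ : Perm (Fin m)) : Perm (Fin (m + l)) :=
  finSumFinEquiv.symm.trans ((sumCongr τ (Equiv.refl _)).trans (finSumEquivOfFinset hS hS'))

theorem gluePerm_castAdd {m l : ℕ} (S : Finset (Fin (m + l))) (hS : S.card = m)
    (hS' : Sᶜ.card = l) (τ : Perm (Fin m)) (i : Fin m) :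
    gluePerm S hS hS' τ (Fin.castAdd l i) = S.orderEmbOfFin hS (τ i) := by
  simp [gluePerm]

theorem gluePerm_natAdd {m l : ℕ} (S : Finset (Fin (m + l))) (hS : S.card = m)
    (hS' : Sᶜ.card = l) (τ : Perm (Fin m)) (i : Fin l) :
    gluePerm S hS hS' τ (Fin.natAdd m i) = Sᶜ.orderEmbOfFin hS' i := by
  simp [gluePerm]

theorem prefixAvoids_gluePerm {m l : ℕ} (S : Finset (Fin (m + l))) (hS : S.card = m)
    (hS' : Sᶜ.card = l) (τ : Perm (Fin m)) :
    PrefixAvoids (gluePerm S hS hS' τ) m ↔ PrefixAvoids τ m := by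
  constructor
  · intro h i j k hij hjk hk hkj hji
    refine h (Fin.castAdd l i) (Fin.castAdd l j) (Fin.castAdd l k) hij hjk hk ?_ ?_ <;>
      simpa [gluePerm_castAdd]
  · intro h i j k hij hjk hk hkj hji
    have hij' : (i : ℕ) < j := hij
    have hjk' : (j : ℕ) < k := hjk
    obtain ⟨i, rfl⟩ : ∃ i', Fin.castAdd l i' = i := ⟨⟨i, by omega⟩, rfl⟩
    obtain ⟨j, rfl⟩ : ∃ i', Fin.castAdd l i' = j := ⟨⟨j, by omega⟩, rfl⟩
    obtain ⟨k, rfl⟩ : ∃ i', Fin.castAdd l i' = k := ⟨⟨k, by omega⟩, rfl⟩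
    simp only [gluePerm_castAdd, OrderEmbedding.lt_iff_lt] at hkj hji
    exact h i j k hij hjk hk hkj hji

theorem increasingFrom_gluePerm {m l : ℕ} (S : Finset (Fin (m + l))) (hS : S.card = m)
    (hS' : Sᶜ.card = l) (τ : Perm (Fin m)) :
    IncreasingFrom (gluePerm S hS hS' τ) m := by
  intro i j hi hij
  have hij' : (i : ℕ) < j := hij
  obtain ⟨i, rfl⟩ : ∃ i', Fin.natAdd m i' = i := ⟨⟨i - m, by omega⟩, Fin.ext (by simp; omega)⟩
  obtain ⟨j, rfl⟩ : ∃ j', Fin.natAdd m j' = j := ⟨⟨j - m, by omega⟩, Fin.ext (by simp; omega)⟩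
  simpa [gluePerm_natAdd] using hij

/-- Recovers `S` from the glued permutation, as injectivity in `griddedCount_add` requires. -/
theorem image_gluePerm {m l : ℕ} (S : Finset (Fin (m + l))) (hS : S.card = m)
    (hS' : Sᶜ.card = l) (τ : Perm (Fin m)) :
    Finset.univ.image (fun i => gluePerm S hS hS' τ (Fin.castAdd l i)) = S := by
  refine Finset.eq_of_subset_of_card_le (fun x hx => ?_) ?_
  · obtain ⟨i, -, rfl⟩ := Finset.mem_image.1 hx
    rw [gluePerm_castAdd]
    exact Finset.orderEmbOfFin_mem S hS _
  · rw [Finset.card_image_of_injective (f := fun i => gluePerm S hS hS' τ (Fin.castAdd l i)) _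
      ((gluePerm S hS hS' τ).injective.comp (Fin.castAdd_injective m l))]
    simp [hS]

theorem exists_gluePerm {m l : ℕ} {σ : Perm (Fin (m + l))} (hσ : IncreasingFrom σ m) :
    ∃ (S : Finset (Fin (m + l))) (hS : S.card = m) (hS' : Sᶜ.card = l) (τ : Perm (Fin m)),
      gluePerm S hS hS' τ = σ := by
  set S := Finset.univ.image (fun i => σ (Fin.castAdd l i)) with hSdef
  have hS : S.card = m := by
    rw [hSdef, Finset.card_image_of_injective (f := fun i => σ (Fin.castAdd l i)) _
      (σ.injective.comp (Fin.castAdd_injective m l))]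
    simp
  have hS' : Sᶜ.card = l := by
    rw [Finset.card_compl, hS]; simp
  have hmem (i : Fin m) : σ (Fin.castAdd l i) ∈ Set.range (S.orderEmbOfFin hS) := by
    rw [Finset.range_orderEmbOfFin]
    exact Finset.mem_coe.2 (Finset.mem_image_of_mem _ (Finset.mem_univ i))
  choose f hf using hmem
  have hinj : Function.Injective f := fun i j hij =>
    Fin.castAdd_injective m l (σ.injective (by rw [← hf, ← hf, hij]))
  refine ⟨S, hS, hS', Equiv.ofBijective f (Finite.injective_iff_bijective.1 hinj),
    Equiv.ext fun i => ?_⟩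
  refine Fin.addCases (fun i => ?_) (fun i => ?_) i
  · rw [gluePerm_castAdd]
    exact hf i
  · rw [gluePerm_natAdd]
    refine (congrFun (Finset.orderEmbOfFin_unique hS' (f := fun i => σ (Fin.natAdd m i))
      (fun i => ?_) (fun i j hij => hσ _ _ (by simp) (by simpa))) i).symm
    rw [Finset.mem_compl]
    intro h
    obtain ⟨j, -, hj⟩ := Finset.mem_image.1 h
    have := congrArg Fin.val (σ.injective hj)
    simp at this
    omega

theorem griddedCount_add (m l : ℕ) :
    griddedCount (m + l) m = (m + l).choose m * catalan m := by
  have hc (S : Finset (Fin (m + l))) (hS : S.card = m) : Sᶜ.card = l := by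
    rw [Finset.card_compl, hS]; simp
  have hcard : (Finset.univ.powersetCard m ×ˢ
      Finset.univ.filter fun τ : Perm (Fin m) => PrefixAvoids τ m ∧ IncreasingFrom τ m :
        Finset (Finset (Fin (m + l)) × Perm (Fin m))).card = (m + l).choose m * catalan m := by
    rw [Finset.card_product, Finset.card_powersetCard, Finset.card_univ, Fintype.card_fin,
      ← avoidCount_self, avoidCount]
  rw [← hcard, griddedCount]
  symm
  have hS {x : Finset (Fin (m + l)) × Perm (Fin m)} (hx : x ∈ Finset.univ.powersetCard m ×ˢ
      Finset.univ.filter fun τ : Perm (Fin m) => PrefixAvoids τ m ∧ IncreasingFrom τ m) :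
      x.1.card = m := (Finset.mem_powersetCard.1 (Finset.mem_product.1 hx).1).2
  refine Finset.card_bij (fun x hx => gluePerm x.1 (hS hx) (hc _ (hS hx)) x.2) ?_ ?_ ?_
  · intro x hx
    refine Finset.mem_filter.2 ⟨Finset.mem_univ _, ?_, increasingFrom_gluePerm _ _ _ _⟩
    rw [prefixAvoids_gluePerm]
    exact (Finset.mem_filter.1 (Finset.mem_product.1 hx).2).2.1
  · rintro ⟨S, τ⟩ hx ⟨T, ρ⟩ hy h
    obtain rfl : S = T := by
      rw [← image_gluePerm S (hS hx) (hc _ (hS hx)) τ, ← image_gluePerm T (hS hy) (hc _ (hS hy)) ρ]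
      simp only at h
      rw [h]
    refine Prod.ext rfl (Equiv.ext fun i => (S.orderEmbOfFin (hS hx)).injective ?_)
    rw [← gluePerm_castAdd S (hS hx) (hc _ (hS hx)), ← gluePerm_castAdd S (hS hx) (hc _ (hS hx))]
    exact congrArg (fun σ : Perm (Fin (m + l)) => σ (Fin.castAdd l i)) h
  · intro σ hσ
    obtain ⟨-, hP, hQ⟩ := Finset.mem_filter.1 hσ
    obtain ⟨S, hS, hS', τ, rfl⟩ := exists_gluePerm hQ
    refine ⟨(S, τ), Finset.mem_product.2 ⟨Finset.mem_powersetCard.2 ⟨Finset.subset_univ _, hS⟩,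
      Finset.mem_filter.2 ⟨Finset.mem_univ _, ?_, increasingFrom_of_le _ (by omega)⟩⟩, rfl⟩
    exact (prefixAvoids_gluePerm S hS hS' τ).1 hP

theorem ncard_classB_add_catalan (n : ℕ) :
    (classB n).ncard + catalan (n + 1) =
      ∑ m ∈ Finset.range (n + 1), n.choose m * catalan m + catalan n := by
  rw [← sum_avoidCount_add, ← add_assoc, ncard_classB_add]
  congr 1
  refine Finset.sum_congr rfl fun m hm => ?_
  obtain ⟨l, rfl⟩ := Nat.exists_eq_add_of_le (Nat.lt_succ_iff.1 (Finset.mem_range.1 hm))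
  exact griddedCount_add m l
-- Generating functions
namespace PowerSeries

theorem constantCoeff_X_mul_mk_one {R : Type*} [CommRing R] :
    constantCoeff (X * mk 1 : R⟦X⟧) = 0 := by simp

/-- Substituting `X / (1 - X)` and dividing by `1 - X` is the binomial transform. -/
theorem mk_one_mul_subst_eq_binomial_transform {R : Type*} [CommRing R] (f : R⟦X⟧) :
    mk 1 * f.subst (X * mk 1 : R⟦X⟧) =
      mk fun n => ∑ k ∈ Finset.range (n + 1), (n.choose k : R) * coeff k f := by
  have hw : HasSubst (X * mk 1 : R⟦X⟧) :=
    HasSubst.of_constantCoeff_zero' constantCoeff_X_mul_mk_one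
  ext n
  have hcoeff (j : ℕ) (hj : j ≤ n) : coeff j (f.subst (X * mk 1 : R⟦X⟧)) =
      ∑ d ∈ Finset.range (n + 1), coeff d f * coeff j ((X * mk 1 : R⟦X⟧) ^ d) := by
    rw [coeff_subst' hw]
    simp only [smul_eq_mul]
    refine finsum_eq_sum_of_support_subset _ fun d hd => ?_
    by_contra h
    have h : j < d := by
      simp only [Finset.coe_range, Set.mem_Iio] at h
      omega
    refine hd ?_
    change coeff d f * coeff j ((X * mk 1 : R⟦X⟧) ^ d) = 0
    rw [mul_pow, coeff_X_pow_mul', if_neg (by omega), mul_zero]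
  have hsum (p : ℕ × ℕ) (hp : p ∈ Finset.HasAntidiagonal.antidiagonal n) :
      coeff p.1 (mk 1 : R⟦X⟧) * coeff p.2 (f.subst (X * mk 1 : R⟦X⟧)) =
        ∑ d ∈ Finset.range (n + 1),
          coeff p.1 (mk 1 : R⟦X⟧) * (coeff d f * coeff p.2 ((X * mk 1 : R⟦X⟧) ^ d)) := by
    rw [hcoeff p.2 (by have := Finset.HasAntidiagonal.mem_antidiagonal.1 hp; omega), Finset.mul_sum]
  rw [coeff_mul, coeff_mk, Finset.sum_congr rfl hsum, Finset.sum_comm]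
  refine Finset.sum_congr rfl fun d hd => ?_
  have hd : d ≤ n := Nat.lt_succ_iff.1 (Finset.mem_range.1 hd)
  -- The coefficient of z^n in z^d/(1-z)^(d+1).
  have h : coeff n (mk 1 * (X * mk 1 : R⟦X⟧) ^ d) = (n.choose d : R) := by
    rw [mul_pow, mul_left_comm, ← pow_succ', mk_one_pow_eq_mk_choose_add, coeff_X_pow_mul',
      if_pos hd, coeff_mk, Nat.add_sub_cancel' hd]
  rw [← h, coeff_mul, Finset.sum_mul]
  exact Finset.sum_congr rfl fun _ _ => by ring

/-- The Catalan series over `ℚ`. -/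
noncomputable def catalanSeriesRat : ℚ⟦X⟧ := map (Nat.castRingHom ℚ) catalanSeries

theorem coeff_catalanSeriesRat (n : ℕ) : coeff n catalanSeriesRat = catalan n := by
  simp [catalanSeriesRat]

theorem constantCoeff_catalanSeriesRat : constantCoeff catalanSeriesRat = 1 := by
  simpa using coeff_catalanSeriesRat 0

theorem catalanSeriesRat_eq : catalanSeriesRat = catalanSeriesRat ^ 2 * X + 1 := by
  have := congrArg (map (Nat.castRingHom ℚ)) catalanSeries_sq_mul_X_add_one
  simpa [catalanSeriesRat] using this.symm

/-- The generating function of the binomial transform of the Catalan numbers. -/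
noncomputable def catalanBinomialSeries : ℚ⟦X⟧ :=
  mk fun n => ∑ k ∈ Finset.range (n + 1), (n.choose k : ℚ) * catalan k

/-- The equation C = 1 + zC² at z/(1-z), rewritten for D = C(z/(1-z))/(1-z). -/
theorem catalanBinomialSeries_eq :
    catalanBinomialSeries * (1 - X) = 1 + X * (1 - X) * catalanBinomialSeries ^ 2 := by
  have hw : HasSubst (X * mk 1 : ℚ⟦X⟧) :=
    HasSubst.of_constantCoeff_zero' constantCoeff_X_mul_mk_one
  have hD : catalanBinomialSeries = mk 1 * catalanSeriesRat.subst (X * mk 1 : ℚ⟦X⟧) := by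
    rw [mk_one_mul_subst_eq_binomial_transform, catalanBinomialSeries]
    simp only [coeff_catalanSeriesRat]
  have hC := congrArg (substAlgHom hw) catalanSeriesRat_eq
  rw [map_add, map_mul, map_pow, map_one, substAlgHom_X] at hC
  rw [coe_substAlgHom] at hC
  have hu := mk_one_mul_one_sub_eq_one ℚ
  rw [hD]
  generalize subst (X * mk 1 : ℚ⟦X⟧) catalanSeriesRat = c at *
  generalize (mk 1 : ℚ⟦X⟧) = u at *
  linear_combination hC + (c - X * u * c ^ 2) * hu

end PowerSeries

open PowerSeries

theorem eq_of_sq_eq_of_constantCoeff_eq_one {f g : ℚ⟦X⟧} (h : f ^ 2 = g ^ 2)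
    (hf : constantCoeff f = 1) (hg : constantCoeff g = 1) : f = g := by
  refine (sq_eq_sq_iff_eq_or_eq_neg.1 h).resolve_right fun h' => ?_
  have := congrArg constantCoeff h'
  rw [map_neg, hf, hg] at this
  norm_num at this

theorem sqrtOneSub_four : sqrtOneSub 4 = 1 - 2 * X * catalanSeriesRat := by
  refine eq_of_sq_eq_of_constantCoeff_eq_one ?_ (constantCoeff_sqrtOneSub 4) (by simp)
  rw [sqrtOneSub_sq, show (C (4 : ℚ) : ℚ⟦X⟧) = 4 from map_ofNat C 4]
  linear_combination 4 * X * catalanSeriesRat_eq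

theorem sqrtOneSub_five :
    sqrtOneSub 5 = sqrtOneSub 1 * (1 - 2 * X * catalanBinomialSeries) := by
  refine eq_of_sq_eq_of_constantCoeff_eq_one ?_ (constantCoeff_sqrtOneSub 5)
    (by simp [constantCoeff_sqrtOneSub])
  rw [mul_pow, sqrtOneSub_sq, sqrtOneSub_sq, show (C (5 : ℚ) : ℚ⟦X⟧) = 5 from map_ofNat C 5,
    map_one]
  linear_combination 4 * X * catalanBinomialSeries_eq

/-- The factor `X` absorbs the index shift in `catalan (n + 1)`. -/
theorem X_mul_genFunB :
    X * genFunB = X * catalanBinomialSeries + X * catalanSeriesRat + 1 - catalanSeriesRat := by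
  have h : X * genFunB + catalanSeriesRat =
      X * catalanBinomialSeries + X * catalanSeriesRat + 1 := by
    ext (_ | n)
    · simp [constantCoeff_catalanSeriesRat]
    · have := ncard_classB_add_catalan n
      simp only [map_add, coeff_succ_X_mul, coeff_catalanSeriesRat, genFunB, catalanBinomialSeries,
        coeff_mk, coeff_one, Nat.add_one_ne_zero, if_false, add_zero]
      exact_mod_cast this
  linear_combination h

/-! ### Closed form, algebraicity and initial values -/

theorem powerSeries_two_ne_zero : (2 : ℚ⟦X⟧) ≠ 0 := by
  intro h
  have := congrArg constantCoeff h
  rw [map_ofNat, map_zero] at this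
  norm_num at this

theorem sqrtOneSub_ne_zero (a : ℚ) : sqrtOneSub a ≠ 0 := by
  intro h
  simpa [h] using constantCoeff_sqrtOneSub a

/-- The closed form of `genFunB`, cleared of denominators. -/
theorem sqrtOneSub_one_mul_genFunB :
    2 * X ^ 2 * sqrtOneSub 1 * genFunB = -(sqrtOneSub 1 * (1 - sqrtOneSub 4) +
      X * (sqrtOneSub 1 * (-4 + sqrtOneSub 4) + sqrtOneSub 5)) := by
  rw [sqrtOneSub_four, sqrtOneSub_five]
  linear_combination 2 * X * sqrtOneSub 1 * X_mul_genFunB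

theorem genFunB_closed_form :
    (genFunB : ℚ⸨X⸩) = -(1 - (sqrtOneSub 4 : ℚ⸨X⸩) + ((X : ℚ⟦X⟧) : ℚ⸨X⸩) *
      (-4 + (sqrtOneSub 4 : ℚ⸨X⸩) + (sqrtOneSub 5 : ℚ⸨X⸩) / (sqrtOneSub 1 : ℚ⸨X⸩))) /
      (2 * ((X : ℚ⟦X⟧) : ℚ⸨X⸩) ^ 2) := by
  have h := congrArg (HahnSeries.ofPowerSeries ℤ ℚ) sqrtOneSub_one_mul_genFunB
  simp only [map_mul, map_neg, map_add, map_sub, map_one, map_pow, map_ofNat] at h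
  have hinj := HahnSeries.ofPowerSeries_injective (Γ := ℤ) (R := ℚ)
  have h1 : HahnSeries.ofPowerSeries ℤ ℚ (sqrtOneSub 1) ≠ 0 :=
    (map_ne_zero_iff _ hinj).2 (sqrtOneSub_ne_zero 1)
  have hX : HahnSeries.ofPowerSeries ℤ ℚ X ≠ 0 := (map_ne_zero_iff _ hinj).2 X_ne_zero
  have h2 : (2 : ℚ⸨X⸩) ≠ 0 := by
    simpa only [map_ofNat] using (map_ne_zero_iff _ hinj).2 powerSeries_two_ne_zero
  rw [eq_div_iff (mul_ne_zero h2 (pow_ne_zero 2 hX))]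
  field_simp
  linear_combination h

theorem isAlgebraic_polynomial_X : IsAlgebraic (Polynomial ℚ) (X : ℚ⟦X⟧) := by
  simpa [algebraMap_apply'] using isAlgebraic_algebraMap (A := ℚ⟦X⟧) (Polynomial.X : Polynomial ℚ)

theorem isAlgebraic_sqrtOneSub (a : ℚ) : IsAlgebraic (Polynomial ℚ) (sqrtOneSub a) := by
  refine IsAlgebraic.of_pow two_pos ?_
  rw [sqrtOneSub_sq]
  have := isAlgebraic_algebraMap (A := ℚ⟦X⟧)
    (1 - Polynomial.C a * Polynomial.X : Polynomial ℚ)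
  rw [map_sub, map_mul, map_one] at this
  simpa [algebraMap_apply'] using this

theorem isAlgebraic_genFunB : IsAlgebraic (Polynomial ℚ) genFunB := by
  have h1 := isAlgebraic_sqrtOneSub 1
  have h4 := isAlgebraic_sqrtOneSub 4
  have h5 := isAlgebraic_sqrtOneSub 5
  have hX := isAlgebraic_polynomial_X
  have hn (k : ℕ) : IsAlgebraic (Polynomial ℚ) (k : ℚ⟦X⟧) := isAlgebraic_natCast k
  -- A factor of an algebraic product is algebraic when the other factor is algebraic and nonzero.
  refine IsAlgebraic.of_mul (y := 2 * X ^ 2 * sqrtOneSub 1) (mem_nonZeroDivisors_of_ne_zero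
    (mul_ne_zero (mul_ne_zero powerSeries_two_ne_zero (pow_ne_zero 2 X_ne_zero)) (sqrtOneSub_ne_zero 1))) ?_ ?_
  · exact ((hn 2).mul (hX.pow 2)).mul h1
  · rw [sqrtOneSub_one_mul_genFunB]
    exact ((h1.mul (isAlgebraic_one.sub h4)).add
      (hX.mul ((h1.mul ((hn 4).neg.add h4)).add h5))).neg

theorem catalan_eq_choose_div (n : ℕ) : catalan n = (2 * n).choose n / (n + 1) := by
  rw [catalan_eq_centralBinom_div, Nat.centralBinom_eq_two_mul_choose]

/-- A form without `catalan`, suited to kernel evaluation. The subtraction is exact, coming from an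
additive identity. -/
theorem ncard_classB_eq (n : ℕ) : (classB n).ncard =
    ∑ m ∈ Finset.range (n + 1), n.choose m * ((2 * m).choose m / (m + 1)) +
      (2 * n).choose n / (n + 1) - (2 * (n + 1)).choose (n + 1) / (n + 1 + 1) := by
  simp only [← catalan_eq_choose_div]
  exact Nat.eq_sub_of_add_eq (ncard_classB_add_catalan n)

theorem mainTheorem1 :
    -- the closed form, in the field of formal Laurent series
    (let z : ℚ⸨X⸩ := ((PowerSeries.X : ℚ⟦X⟧) : ℚ⸨X⸩)
     let r₁ : ℚ⸨X⸩ := (sqrtOneSub 1 : ℚ⸨X⸩)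
     let r₄ : ℚ⸨X⸩ := (sqrtOneSub 4 : ℚ⸨X⸩)
     let r₅ : ℚ⸨X⸩ := (sqrtOneSub 5 : ℚ⸨X⸩)
     (genFunB : ℚ⸨X⸩) = -(1 - r₄ + z * (-4 + r₄ + r₅ / r₁)) / (2 * z ^ 2)) ∧
    -- the generating function is algebraic
    IsAlgebraic (Polynomial ℚ) genFunB ∧
    -- the initial terms, for lengths 1 to 12
    (List.range' 1 12).map (fun n => (classB n).ncard) =
      [1, 2, 6, 23, 98, 434, 1949, 8803, 39888, 181201, 825201, 3767757] := by
  refine ⟨genFunB_closed_form, isAlgebraic_genFunB, ?_⟩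
  simp only [ncard_classB_eq]
  decide +kernel
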